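/- Let $k$ be a field. For a finite simple graph $G=(V,E)$ let $S=k[x_v: v\in V]$, let $I(G)\subseteq S$ be the ideal generated by the monomials $x_ix_j$ with $\{i,j\}\in E$, and let $k[G]=S/I(G)$ be the edge ring of $G$. One says that $k[G]$ has a 2-linear resolution if it has a finite graded free resolution over $S$ of the form $$0\leftarrow k[G]\leftarrow S\leftarrow S(-2)^{b_1}\leftarrow S(-3)^{b_2}\leftarrow\cdots\leftarrow S(-p-1)^{b_p}\leftarrow 0 .$$ Call $G$ a counterexample (over $k$) to the conjecture "if $k[G]$ has a 2-linear resolution, then the projective dimension $\mathrm{pd}_S(k[G])$ equals the maximal degree of a vertex of $G$" if $k[G]$ has a 2-linear resolution but $\mathrm{pd}_S(k[G])$ is different from the maximal degree of a vertex of $G$ (this maximum being $0$ for the graph without vertices). Then the 4-cycle $C_4$ is the smallest counterexample: $C_4$ is a counterexample, every counterexample has at least four vertices, and every counterexample with exactly four vertices is isomorphic to $C_4$. Moreover, let $C_4$ be the 4-cycle on the vertex set $\{1,2,3,4\}$ with edges $\{1,3\},\{3,2\},\{2,4\},\{4,1\}$, and let $\Delta$ be the largest simplicial complex on $\{1,2,3,4\}$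 whose 1-skeleton is the complement graph $\overline{C_4}$. Then the facets of $\Delta$ are exactly $\{1,2\}$ and $\{3,4\}$; the ideal $I(C_4)$ equals the Stanley-Reisner ideal of $\Delta$ (the ideal generated by the squarefree monomials $\prod_{i\in s}x_i$ with $s\subseteq\{1,2,3,4\}$ not a face of $\Delta$), so that $k[C_4]$ is the Stanley-Reisner ring of $\Delta$; $\mathrm{pd}_S(k[C_4])=3$; and the maximal degree of a vertex of $C_4$ is $2$. -/

import Mathlib

universe u v

noncomputable section

/-- The edge ideal `I(G) = (x_i x_j : {i, j} an edge of G)` in `k[x_v : v ∈ V]`. -/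
def edgeIdeal {V : Type v} (k : Type u) [Field k] (G : SimpleGraph V) :
    Ideal (MvPolynomial V k) :=
  Ideal.span {f | ∃ i j, G.Adj i j ∧ f = MvPolynomial.X i * MvPolynomial.X j}

/-- The edge ring `k[G] = k[x_v : v ∈ V] / I(G)`. -/
abbrev EdgeRing {V : Type v} (k : Type u) [Field k] (G : SimpleGraph V) : Type (max u v) :=
  MvPolynomial V k ⧸ edgeIdeal k G

/-- The projective dimension of `k[G]` as a module over `S = k[x_v : v ∈ V]`. -/
def edgeRingPd {V : Type v} (k : Type u) [Field k] (G : SimpleGraph V) : WithBot ℕ∞ :=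
  CategoryTheory.projectiveDimension (ModuleCat.of (MvPolynomial V k) (EdgeRing k G))

/-- With `S = k[x_v : v ∈ V]`, the quotient `S / I` has a 2-linear resolution: there is a graded
free resolution of finite length
`0 ← S/I ← S ← S(-2)^{b 0} ← S(-3)^{b 1} ← S(-4)^{b 2} ← ⋯ ← 0`.
A degree-preserving map `S(-2)^{b 0} → S` is a row of forms of degree 2, and a degree-preserving
map `S(-i-3)^{b (i+1)} → S(-i-2)^{b i}` is a matrix of forms of degree 1 (the zero polynomial
being a form of every degree). Exactness at `S` and at `S/I` says that the image of `S(-2)^{b 0}`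
is `I`. -/
def HasTwoLinearResolution {V : Type v} {k : Type u} [Field k]
    (I : Ideal (MvPolynomial V k)) : Prop :=
  ∃ (b : ℕ → ℕ)
    (ε : (Fin (b 0) → MvPolynomial V k) →ₗ[MvPolynomial V k] MvPolynomial V k)
    (d : ∀ i : ℕ, (Fin (b (i + 1)) → MvPolynomial V k) →ₗ[MvPolynomial V k]
      (Fin (b i) → MvPolynomial V k)),
    (∃ p, ∀ i, p ≤ i → b i = 0) ∧
    (∀ s, (ε (Pi.single s 1)).IsHomogeneous 2) ∧
    (∀ i s t, (d i (Pi.single s 1) t).IsHomogeneous 1) ∧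
    LinearMap.range ε = I ∧
    Function.Exact (d 0) ε ∧
    ∀ i, Function.Exact (d (i + 1)) (d i)

/-- `G` is a counterexample over `k` to the conjecture "if `k[G]` has a 2-linear resolution, then
the projective dimension of `k[G]` equals the maximal degree of a vertex of `G`". -/
def IsCounterexample {V : Type v} [Fintype V] (k : Type u) [Field k] (G : SimpleGraph V)
    [DecidableRel G.Adj] : Prop :=
  HasTwoLinearResolution (edgeIdeal k G) ∧ edgeRingPd k G ≠ (G.maxDegree : WithBot ℕ∞)

/-- The 1-skeleton of a simplicial complex, as a graph. -/
def oneSkeleton {V : Type v} [DecidableEq V] (D : AbstractSimplicialComplex V) :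
    SimpleGraph V where
  Adj a b := a ≠ b ∧ ({a, b} : Finset V) ∈ D.faces
  symm := ⟨fun a b h => ⟨h.1.symm, by rw [Finset.pair_comm]; exact h.2⟩⟩
  loopless := ⟨fun _ h => h.1 rfl⟩

/-- `Δ(G)`, the largest simplicial complex with 1-skeleton `G` (see `isGreatest_largestComplex`):
its faces are the non-empty finite cliques of `G`. -/
def largestComplex {V : Type v} (G : SimpleGraph V) : AbstractSimplicialComplex V where
  faces := {s | s.Nonempty ∧ G.IsClique (s : Set V)}
  isRelLowerSet_faces := fun _ hs =>
    ⟨hs.1, fun _ hts ht => ⟨ht, hs.2.subset (Finset.coe_subset.mpr hts)⟩⟩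
  singleton_mem := fun a => ⟨Finset.singleton_nonempty a, by simp⟩

theorem isGreatest_largestComplex {V : Type v} [DecidableEq V] (G : SimpleGraph V) :
    IsGreatest {D : AbstractSimplicialComplex V | oneSkeleton D = G} (largestComplex G) := by
  constructor
  · ext a b
    simp only [oneSkeleton, largestComplex, Set.mem_ofPred_eq]
    constructor
    · rintro ⟨hab, -, h⟩
      exact h (by simp) (by simp) hab
    · intro h
      refine ⟨h.ne, by simp, ?_⟩
      intro x hx y hy hxy
      simp only [Finset.coe_insert, Finset.coe_singleton, Set.mem_insert_iff,
        Set.mem_singleton_iff] at hx hy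
      rcases hx with rfl | rfl <;> rcases hy with rfl | rfl
      · exact absurd rfl hxy
      · exact h
      · exact h.symm
      · exact absurd rfl hxy
  · rintro D rfl s hs
    refine ⟨(D.isRelLowerSet_faces hs).1, fun a ha b hb hab => ⟨hab, ?_⟩⟩
    refine (D.isRelLowerSet_faces hs).2 ?_ (Finset.insert_nonempty _ _)
    intro x hx
    simp only [Finset.mem_insert, Finset.mem_singleton] at hx
    rcases hx with rfl | rfl
    · exact ha
    · exact hb

/-- The facets (maximal faces) of a simplicial complex. -/
def facets {V : Type v} (D : AbstractSimplicialComplex V) : Set (Finset V) :=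
  {s | Maximal (fun t => t ∈ D.faces) s}

/-- The Stanley-Reisner ideal `I(Δ)`, generated by the squarefree monomials whose support is not
a face of `Δ`. (The empty set is not listed in `faces`, but counts as a face.) -/
def stanleyReisnerIdeal {V : Type v} (k : Type u) [Field k] (D : AbstractSimplicialComplex V) :
    Ideal (MvPolynomial V k) :=
  Ideal.span {f | ∃ s : Finset V, s.Nonempty ∧ s ∉ D.faces ∧ f = ∏ i ∈ s, MvPolynomial.X i}

/-- The 4-cycle `0 - 2 - 1 - 3 - 0` on the vertex set `{0, 1, 2, 3}`. -/
abbrev fourCycle : SimpleGraph (Fin 4) :=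
  (SimpleGraph.cycleGraph 4).comap (Equiv.swap (1 : Fin 4) 2)

end

/-! Lower bound, valid for every finite graph: the class of `X w` in `k[G]` is nonzero and is killed
by the variables of the neighbors of `w`. These form a regular sequence of length `deg w`, which
forces `pd k[G] ≥ deg w` (`eq_zero_of_pdLT_length`, `not_pdLT_maxDegree`).

Upper bound, on at most four vertices without induced 2K₂ or C₄: let `w` have maximal degree. Its
neighbors `N` meet every edge, so `I(G) : X w = (N)`, while `I(G) + (X w) = I(G - w) + (X w)`. In `0
→ S/(N) → S/I(G) → S/(I(G - w), X w) → 0` the left term has `pd ≤ deg w`. The right one has `pd ≤ pd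
k[G - w] + 1`, which is at most `deg w` by induction, because deleting `w` lowers the maximal degree
(`degreeLE_of_deleted`, `pdLT_edgeRing_of_degreeLE`).

A 2-linear resolution rules out 2K₂ on four vertices, since the syzygy of two coprime quadrics is
not linear. So a counterexample with at most four vertices has an induced C₄, hence is C₄.

For C₄ itself, `I = P ∩ Q` with `P = (X 0, X 1)` and `Q = (X 2, X 3)`. The sequence `0 → S/I → S/P ⊕
S/Q → k → 0` gives `pd ≥ 3`, the colon sequence gives `pd ≤ 3`, and the linear resolution is written
out. -/

open CategoryTheory

/-! ### Projective dimension in short exact sequences and under reduction modulo a regular element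
-/

section ProjectiveDimension

variable {R : Type u} [CommRing R] {M N P : Type u} [AddCommGroup M] [AddCommGroup N]
  [AddCommGroup P] [Module R M] [Module R N] [Module R P]

theorem shortExact_of_linearMap {f : M →ₗ[R] N} {g : N →ₗ[R] P} (hf : Function.Injective f)
    (hfg : Function.Exact f g) (hg : Function.Surjective g) :
    (ModuleCat.shortComplexOfCompEqZero f g hfg.linearMap_comp_eq_zero).ShortExact :=
  ModuleCat.shortComplex_shortExact _ hfg hf hg

/-- The `R`-module `M` has projective dimension less than `n`. -/
abbrev PdLT (R : Type u) [CommRing R] (M : Type u) [AddCommGroup M] [Module R M] (n : ℕ) : Prop :=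
  HasProjectiveDimensionLT (ModuleCat.of R M) n

theorem PdLT.mono {m n : ℕ} (h : PdLT R M m) (hmn : m ≤ n) : PdLT R M n :=
  hasProjectiveDimensionLT_of_ge _ m n hmn

theorem PdLT.of_equiv {n : ℕ} (h : PdLT R M n) (e : M ≃ₗ[R] N) : PdLT R N n :=
  hasProjectiveDimensionLT_of_iso e.toModuleIso n

theorem pdLT_zero_iff : PdLT R M 0 ↔ Subsingleton M := by
  rw [PdLT, hasProjectiveDimensionLT_zero_iff_isZero, ModuleCat.isZero_iff_subsingleton]

theorem pdLT_one_iff : PdLT R M 1 ↔ Module.Projective R M := by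
  rw [PdLT, ← projective_iff_hasProjectiveDimensionLT_one, ← IsProjective.iff_projective]

theorem PdLT.middle {f : M →ₗ[R] N} {g : N →ₗ[R] P} (hf : Function.Injective f)
    (hfg : Function.Exact f g) (hg : Function.Surjective g) {n : ℕ} (h₁ : PdLT R M n)
    (h₃ : PdLT R P n) : PdLT R N n :=
  (shortExact_of_linearMap hf hfg hg).hasProjectiveDimensionLT_X₂ n h₁ h₃

theorem PdLT.right {f : M →ₗ[R] N} {g : N →ₗ[R] P} (hf : Function.Injective f)
    (hfg : Function.Exact f g) (hg : Function.Surjective g) {n : ℕ} (h₁ : PdLT R M n)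
    (h₂ : PdLT R N (n + 1)) : PdLT R P (n + 1) :=
  (shortExact_of_linearMap hf hfg hg).hasProjectiveDimensionLT_X₃ n h₁ h₂

theorem PdLT.left {f : M →ₗ[R] N} {g : N →ₗ[R] P} (hf : Function.Injective f)
    (hfg : Function.Exact f g) (hg : Function.Surjective g) {n : ℕ} (h₂ : PdLT R N n)
    (h₃ : PdLT R P (n + 1)) : PdLT R M n :=
  (shortExact_of_linearMap hf hfg hg).hasProjectiveDimensionLT_X₁ n h₂ h₃

theorem PdLT.prod {n : ℕ} (h₁ : PdLT R M n) (h₂ : PdLT R N n) : PdLT R (M × N) n :=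
  PdLT.middle LinearMap.inl_injective .inl_snd LinearMap.snd_surjective h₁ h₂

/-- If `f m = x n`, then `x` kills `g n`, so `g n = 0` by regularity on `P`. Thus `n` comes from
`M`, and injectivity of `f` gives `m ∈ xM`. -/
theorem quotSMulTop_map_injective (x : R) {f : M →ₗ[R] N} {g : N →ₗ[R] P}
    (hf : Function.Injective f) (hfg : Function.Exact f g) (hP : IsSMulRegular P x) :
    Function.Injective (QuotSMulTop.map x f) := by
  have h0 : Function.Exact (0 : M →ₗ[R] M) f := by
    rw [LinearMap.exact_iff, LinearMap.ker_eq_bot.mpr hf, LinearMap.range_zero]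
  have h1 := QuotSMulTop.map_first_exact_on_four_term_exact_of_isSMulRegular_last h0 hfg hP
  rw [LinearMap.exact_iff, map_zero, LinearMap.range_zero] at h1
  exact LinearMap.ker_eq_bot.mp h1

instance projective_quotSMulTop (x : R) [Module.Projective R M] :
    Module.Projective (R ⧸ Ideal.span {x}) (QuotSMulTop x M) :=
  Module.Projective.of_equiv' ((QuotSMulTop.equivQuotTensor x M).extendScalarsOfSurjective
    Ideal.Quotient.mk_surjective).symm

/-- Change of rings: reducing modulo an element that is regular on the ring and on the module does
not increase the projective dimension. -/
theorem PdLT.quotSMulTop {x : R} (hx : IsSMulRegular R x) (n : ℕ) :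
    ∀ (M : Type u) [AddCommGroup M] [Module R M], IsSMulRegular M x → PdLT R M n →
      PdLT (R ⧸ Ideal.span {x}) (QuotSMulTop x M) n := by
  induction n with
  | zero =>
    intro M _ _ _ h
    rw [pdLT_zero_iff] at h ⊢
    infer_instance
  | succ n ih =>
    intro M _ _ hM h
    -- The projective case is separate: the syzygy argument needs the free cover to satisfy the
    -- bound that is one smaller, which must therefore be at least 1.
    obtain _ | n := n
    · rw [pdLT_one_iff] at h ⊢
      infer_instance
    let f : (M →₀ R) →ₗ[R] M := Finsupp.linearCombination R id
    have hf : Function.Surjective f := Finsupp.linearCombination_id_surjective R M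
    have hex : Function.Exact (LinearMap.ker f).subtype f := f.exact_subtype_ker_map
    have hinj : Function.Injective (LinearMap.ker f).subtype := Subtype.val_injective
    have hF : IsSMulRegular (M →₀ R) x := fun a b hab => by
      ext i
      exact hx (DFunLike.congr_fun hab i)
    have hfree : PdLT R (M →₀ R) 1 := pdLT_one_iff.mpr inferInstance
    -- The first syzygy lies in a free module, so `x` is regular on it, and its bound is one
    -- smaller. Reduction modulo `x` keeps the presentation exact because `x` is regular on `M`.
    have hK := ih (LinearMap.ker f) (hF.submodule _ _)
      (PdLT.left hinj hex hf (hfree.mono (by omega)) h)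
    have hfree' : PdLT (R ⧸ Ideal.span {x}) (QuotSMulTop x (M →₀ R)) 1 :=
      pdLT_one_iff.mpr inferInstance
    refine PdLT.right
      (f := (QuotSMulTop.map x (LinearMap.ker f).subtype).extendScalarsOfSurjective
        Ideal.Quotient.mk_surjective)
      (g := (QuotSMulTop.map x f).extendScalarsOfSurjective Ideal.Quotient.mk_surjective)
      ?_ ?_ ?_ hK (hfree'.mono (by omega))
    · exact quotSMulTop_map_injective x hinj hex hM
    · exact QuotSMulTop.map_exact x hex hf
    · exact QuotSMulTop.map_surjective x hf

end ProjectiveDimension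

/-! ### Elements killed by a regular sequence -/

section Socle
open RingTheory.Sequence Pointwise

/-- A module whose projective dimension is less than the length of a weakly regular sequence has
no non-zero element killed by the sequence. -/
theorem eq_zero_of_pdLT_length (n : ℕ) :
    ∀ (R : Type u) [CommRing R] (M : Type u) [AddCommGroup M] [Module R M] (rs : List R),
      rs.length = n → IsWeaklyRegular R rs → PdLT R M n →
      ∀ m : M, (∀ r ∈ rs, r • m = 0) → m = 0 := by
  induction n with
  | zero =>
    intro R _ M _ _ rs _ _ h m _
    have := pdLT_zero_iff.mp h
    exact Subsingleton.elim _ _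
  | succ n ih =>
    intro R _ M _ _ rs hlen hreg h m hm
    obtain _ | ⟨x, rs⟩ := rs
    · simp at hlen
    obtain ⟨hx, hrs⟩ := (isWeaklyRegular_cons_iff' R x rs).mp hreg
    let f : (M →₀ R) →ₗ[R] M := Finsupp.linearCombination R id
    have hf : Function.Surjective f := Finsupp.linearCombination_id_surjective R M
    have hex : Function.Exact (LinearMap.ker f).subtype f := f.exact_subtype_ker_map
    have hinj : Function.Injective (LinearMap.ker f).subtype := Subtype.val_injective
    have hF : IsSMulRegular (M →₀ R) x := fun a b hab => by
      ext i
      exact hx (DFunLike.congr_fun hab i)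
    -- For a sequence of length one, `M` is projective and embeds in a free module, where `x` kills
    -- nothing.
    obtain _ | n := n
    · have := pdLT_one_iff.mp h
      obtain ⟨s, hs⟩ := Module.projective_lifting_property f LinearMap.id hf
      have h1 : x • s m = 0 := by rw [← map_smul, hm x (by simp), map_zero]
      have h2 : s m = 0 := hF (by simpa using h1)
      simpa [h2] using (LinearMap.congr_fun hs m).symm
    have hfree : PdLT R (M →₀ R) 1 := pdLT_one_iff.mpr inferInstance
    -- With `K` the kernel of the free cover, the induction passes from `(R, M, x :: rs)` to `(R/x,
    -- K/xK, rs)`, lowering length and bound by one.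
    have hK := PdLT.quotSMulTop hx (n + 1) (LinearMap.ker f) (hF.submodule _ _)
      (PdLT.left hinj hex hf (hfree.mono (by omega)) h)
    obtain ⟨y, rfl⟩ := hf m
    have hxy : ∀ r ∈ x :: rs, r • y ∈ LinearMap.ker f := fun r hr => by
      rw [LinearMap.mem_ker, map_smul, hm r hr]
    have hreg' : IsWeaklyRegular (R ⧸ Ideal.span {x})
        (rs.map (Ideal.Quotient.mk (Ideal.span {x}))) := by
      refine (LinearEquiv.isWeaklyRegular_congr (LinearEquiv.extendScalarsOfSurjective
        (R := R) (S := R ⧸ Ideal.span {x}) Ideal.Quotient.mk_surjective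
        (Submodule.quotEquivOfEq (x • (⊤ : Submodule R R)) (Ideal.span {x}) ?_)) _).mp hrs
      rw [← Submodule.ideal_span_singleton_smul, smul_eq_mul, Ideal.mul_top]
    -- If `y` lifts `m`, then `x • y ∈ K`, and its class in `K/xK` is killed by each `r` in `rs`: `r
    -- • x • y = x • (r • y)` with `r • y ∈ K`.
    have key := ih (R ⧸ Ideal.span {x}) (QuotSMulTop x (LinearMap.ker f)) _
      (by simpa using hlen) hreg' hK
      (Submodule.Quotient.mk ⟨x • y, hxy x (by simp)⟩) (by
        intro r hr
        obtain ⟨r, hrs', rfl⟩ := List.mem_map.mp hr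
        change Submodule.Quotient.mk (r • (⟨x • y, hxy x (by simp)⟩ : LinearMap.ker f)) = _
        rw [Submodule.Quotient.mk_eq_zero, Submodule.mem_smul_pointwise_iff_exists]
        exact ⟨⟨r • y, hxy r (by simp [hrs'])⟩, trivial, Subtype.ext (smul_comm x r y)⟩)
    rw [Submodule.Quotient.mk_eq_zero, Submodule.mem_smul_pointwise_iff_exists] at key
    obtain ⟨z, -, hz⟩ := key
    -- The class vanishes, so `x • y = x • z` with `z ∈ K`. Cancelling `x` in the free module gives
    -- `y ∈ K`, that is, `m = 0`.
    have hzy : (z : M →₀ R) = y := hF (congrArg Subtype.val hz)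
    rw [← hzy]
    exact z.2

end Socle

/-! ### Colon ideals, variable ideals and edge ideals -/

section MonomialIdeals

open MvPolynomial

variable {V : Type v} {k : Type u} [Field k]

/-- By `h`, `J` is the colon ideal `I : x`, so multiplication by `x` embeds `R/J` in `R/I`, with
image the kernel of the projection to `R/(I + (x))`. -/
theorem exists_exact_of_colon {R : Type u} [CommRing R] {I J : Ideal R} {x : R}
    (h : ∀ f, x * f ∈ I ↔ f ∈ J) :
    ∃ (f : (R ⧸ J) →ₗ[R] (R ⧸ I)) (g : (R ⧸ I) →ₗ[R] (R ⧸ (I ⊔ Ideal.span {x}))),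
      Function.Injective f ∧ Function.Exact f g ∧ Function.Surjective g := by
  have hJ : J ≤ Submodule.comap (LinearMap.mulLeft R x) I := fun f hf => (h f).mpr hf
  refine ⟨Submodule.mapQ J I (LinearMap.mulLeft R x) hJ,
    Submodule.factor (le_sup_left : I ≤ I ⊔ Ideal.span {x}), ?_, ?_, ?_⟩
  · refine (injective_iff_map_eq_zero _).mpr fun a ha => ?_
    obtain ⟨a, rfl⟩ := Submodule.Quotient.mk_surjective _ a
    rw [Submodule.mapQ_apply, Submodule.Quotient.mk_eq_zero] at ha
    rw [Submodule.Quotient.mk_eq_zero]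
    exact (h a).mp ha
  · intro a
    obtain ⟨a, rfl⟩ := Submodule.Quotient.mk_surjective _ a
    change Submodule.Quotient.mk a = 0 ↔ _
    rw [Submodule.Quotient.mk_eq_zero, Submodule.mem_sup]
    constructor
    · rintro ⟨y, hy, z, hz, rfl⟩
      obtain ⟨c, rfl⟩ := Ideal.mem_span_singleton'.mp hz
      refine ⟨Submodule.Quotient.mk c, ?_⟩
      rw [Submodule.mapQ_apply, Submodule.Quotient.eq]
      simpa [mul_comm] using hy
    · rintro ⟨c, hc⟩
      obtain ⟨c, rfl⟩ := Submodule.Quotient.mk_surjective _ c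
      rw [Submodule.mapQ_apply, eq_comm, Submodule.Quotient.eq] at hc
      exact ⟨_, hc, c * x, Ideal.mem_span_singleton'.mpr ⟨c, rfl⟩, by simp [mul_comm]⟩
  · exact Submodule.factor_surjective _

theorem PdLT.of_colon {R : Type u} [CommRing R] {I J : Ideal R} {x : R}
    (h : ∀ f, x * f ∈ I ↔ f ∈ J) {n : ℕ} (hJ : PdLT R (R ⧸ J) n)
    (hx : PdLT R (R ⧸ (I ⊔ Ideal.span {x})) n) : PdLT R (R ⧸ I) n := by
  obtain ⟨f, g, hf, hfg, hg⟩ := exists_exact_of_colon h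
  exact PdLT.middle hf hfg hg hJ hx

/-- Here `x` is a nonzerodivisor on `R/I`, so the colon sequence has `R/I` in both of its first
places. -/
theorem PdLT.sup_span_singleton {R : Type u} [CommRing R] {I : Ideal R} {x : R}
    (h : ∀ f, x * f ∈ I → f ∈ I) {n : ℕ} (hI : PdLT R (R ⧸ I) n) :
    PdLT R (R ⧸ (I ⊔ Ideal.span {x})) (n + 1) := by
  obtain ⟨f, g, hf, hfg, hg⟩ := exists_exact_of_colon fun f => ⟨h f, fun hf => I.mul_mem_left x hf⟩
  exact PdLT.right hf hfg hg hI (hI.mono n.le_succ)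

/-- The ideal generated by the variables in `N`. -/
noncomputable def varIdeal (k : Type u) [Field k] (N : Set V) : Ideal (MvPolynomial V k) :=
  Ideal.span (X '' N)

theorem mem_varIdeal {N : Set V} {f : MvPolynomial V k} :
    f ∈ varIdeal k N ↔ ∀ m ∈ f.support, ∃ i ∈ N, m i ≠ 0 :=
  mem_ideal_span_X_image

theorem X_mem_varIdeal {N : Set V} {w : V} (hw : w ∈ N) :
    (X w : MvPolynomial V k) ∈ varIdeal k N :=
  Ideal.subset_span ⟨w, hw, rfl⟩

theorem add_single_mem_support {w : V} {f : MvPolynomial V k} {m : V →₀ ℕ} (hm : m ∈ f.support) :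
    m + Finsupp.single w 1 ∈ (X w * f).support := by
  rw [mul_comm, mem_support_iff, coeff_mul_X]
  exact mem_support_iff.mp hm

theorem mem_varIdeal_of_X_mul_mem {N : Set V} {w : V} (hw : w ∉ N) {f : MvPolynomial V k}
    (hf : X w * f ∈ varIdeal k N) : f ∈ varIdeal k N := by
  rw [mem_varIdeal] at hf ⊢
  intro m hm
  obtain ⟨i, hi, hmi⟩ := hf _ (add_single_mem_support hm)
  have hwi : w ≠ i := fun h => hw (h ▸ hi)
  exact ⟨i, hi, by simpa [Finsupp.single_apply, hwi] using hmi⟩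

theorem varIdeal_insert (N : Set V) (w : V) :
    varIdeal k (insert w N) = varIdeal k N ⊔ Ideal.span {X w} := by
  rw [varIdeal, Set.image_insert_eq, Ideal.span_insert, sup_comm, varIdeal]

/-- The variables are adjoined one at a time, each regular modulo the previous ones, and each costs
at most one. -/
theorem pdLT_quotient_varIdeal (N : Finset V) :
    PdLT (MvPolynomial V k) (MvPolynomial V k ⧸ varIdeal k (N : Set V)) (N.card + 1) := by
  classical
  induction N using Finset.induction_on with
  | empty =>
    have : varIdeal k ((∅ : Finset V) : Set V) = ⊥ := by simp [varIdeal]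
    rw [this]
    exact PdLT.of_equiv (pdLT_one_iff.mpr inferInstance) (Submodule.quotEquivOfEqBot ⊥ rfl).symm
  | insert w N hw ih =>
    rw [Finset.coe_insert, varIdeal_insert, Finset.card_insert_of_notMem hw]
    exact PdLT.sup_span_singleton
      (fun f => mem_varIdeal_of_X_mul_mem (by simpa using hw)) ih

theorem isWeaklyRegular_map_X {l : List V} (hl : l.Nodup) :
    RingTheory.Sequence.IsWeaklyRegular (MvPolynomial V k)
      (l.map (X : V → MvPolynomial V k)) := by
  refine ⟨fun i hi => ?_⟩
  have hI : (Ideal.ofList ((l.map (X : V → MvPolynomial V k)).take i) • ⊤ :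
      Submodule (MvPolynomial V k) (MvPolynomial V k)) = varIdeal k {w | w ∈ l.take i} := by
    rw [smul_eq_mul, Ideal.mul_top, ← List.map_take, Ideal.ofList, varIdeal]
    congr 1
    ext
    simp only [Set.mem_ofPred_eq, List.mem_map, Set.mem_image]
  rw [isSMulRegular_quotient_iff_mem_of_smul_mem, hI]
  intro f hf
  rw [List.length_map] at hi
  rw [List.getElem_map, smul_eq_mul] at hf
  refine mem_varIdeal_of_X_mul_mem ?_ hf
  simp only [Set.mem_ofPred_eq, List.mem_take_iff_getElem, not_exists]
  intro j hj h
  have := (List.Nodup.getElem_inj_iff hl).mp h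
  omega

theorem not_pdLT_card {I : Ideal (MvPolynomial V k)} {f : MvPolynomial V k} (hf : f ∉ I)
    (N : Finset V) (hN : ∀ w ∈ N, X w * f ∈ I) :
    ¬ PdLT (MvPolynomial V k) (MvPolynomial V k ⧸ I) N.card := by
  intro h
  refine hf (Ideal.Quotient.eq_zero_iff_mem.mp (eq_zero_of_pdLT_length N.card _ _
    (N.toList.map (X : V → MvPolynomial V k)) (by simp) (isWeaklyRegular_map_X N.nodup_toList) h
    (Ideal.Quotient.mk I f) ?_))
  intro r hr
  obtain ⟨w, hw, rfl⟩ := List.mem_map.mp hr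
  exact Ideal.Quotient.eq_zero_iff_mem.mpr (hN w (Finset.mem_toList.mp hw))

/-- The exponents of the generators of the edge ideal. -/
def edgeExponents (G : SimpleGraph V) : Set (V →₀ ℕ) :=
  {m | ∃ i j, G.Adj i j ∧ m = Finsupp.single i 1 + Finsupp.single j 1}

theorem edgeIdeal_eq_span_monomial (G : SimpleGraph V) :
    edgeIdeal k G = Ideal.span ((fun m => monomial m (1 : k)) '' edgeExponents G) := by
  rw [edgeIdeal]
  congr 1
  ext f
  constructor
  · rintro ⟨i, j, h, rfl⟩
    exact ⟨_, ⟨i, j, h, rfl⟩, by simp [X, monomial_mul]⟩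
  · rintro ⟨_, ⟨i, j, h, rfl⟩, rfl⟩
    exact ⟨i, j, h, by simp [X, monomial_mul]⟩

theorem single_add_single_le_iff {i j : V} (hij : i ≠ j) (m : V →₀ ℕ) :
    Finsupp.single i 1 + Finsupp.single j 1 ≤ m ↔ m i ≠ 0 ∧ m j ≠ 0 := by
  classical
  constructor
  · intro h
    have hi := h i
    have hj := h j
    simp only [Finsupp.add_apply, Finsupp.single_apply, hij, hij.symm, if_true, if_false] at hi hj
    omega
  · rintro ⟨hi, hj⟩ w
    simp only [Finsupp.add_apply, Finsupp.single_apply]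
    split_ifs with h1 h2 h2
    · exact absurd (h1.trans h2.symm) hij
    · subst h1; omega
    · subst h2; omega
    · omega

theorem mem_edgeIdeal {G : SimpleGraph V} {f : MvPolynomial V k} :
    f ∈ edgeIdeal k G ↔ ∀ m ∈ f.support, ∃ i j, G.Adj i j ∧ m i ≠ 0 ∧ m j ≠ 0 := by
  rw [edgeIdeal_eq_span_monomial, mem_ideal_span_monomial_image]
  refine forall₂_congr fun m _ => ⟨?_, ?_⟩
  · rintro ⟨_, ⟨i, j, h, rfl⟩, hm⟩
    exact ⟨i, j, h, (single_add_single_le_iff h.ne m).mp hm⟩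
  · rintro ⟨i, j, h, hm⟩
    exact ⟨_, ⟨i, j, h, rfl⟩, (single_add_single_le_iff h.ne m).mpr hm⟩

theorem X_mul_X_mem_edgeIdeal {G : SimpleGraph V} {i j : V} (h : G.Adj i j) :
    (X i * X j : MvPolynomial V k) ∈ edgeIdeal k G :=
  Ideal.subset_span ⟨i, j, h, rfl⟩

theorem X_notMem_edgeIdeal (G : SimpleGraph V) (w : V) :
    (X w : MvPolynomial V k) ∉ edgeIdeal k G := by
  classical
  rw [mem_edgeIdeal]
  intro h
  obtain ⟨i, j, hij, hi, hj⟩ := h (Finsupp.single w 1) (by simp [X])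
  simp only [Finsupp.single_apply, ne_eq, ite_eq_right_iff, Classical.not_imp] at hi hj
  exact hij.ne (hi.1.symm.trans hj.1)

theorem one_notMem_edgeIdeal (G : SimpleGraph V) : (1 : MvPolynomial V k) ∉ edgeIdeal k G := by
  rw [mem_edgeIdeal]
  intro h
  obtain ⟨i, j, -, hi, -⟩ := h 0 (by simp)
  simp at hi

/-- The element `X w` is nonzero in `k[G]`, and each neighbor's variable kills it. -/
theorem not_pdLT_card_neighbors (G : SimpleGraph V) (w : V) (N : Finset V)
    (hN : ∀ a ∈ N, G.Adj w a) : ¬ PdLT (MvPolynomial V k) (EdgeRing k G) N.card :=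
  not_pdLT_card (X_notMem_edgeIdeal G w) N fun a ha => X_mul_X_mem_edgeIdeal (hN a ha).symm

theorem mem_edgeIdeal_of_X_mul_mem {G : SimpleGraph V} {w : V} (hw : ∀ a, ¬ G.Adj w a)
    {f : MvPolynomial V k} (hf : X w * f ∈ edgeIdeal k G) : f ∈ edgeIdeal k G := by
  rw [mem_edgeIdeal] at hf ⊢
  intro m hm
  obtain ⟨i, j, hij, hi, hj⟩ := hf _ (add_single_mem_support hm)
  have hwi : w ≠ i := fun h => hw j (h ▸ hij)
  have hwj : w ≠ j := fun h => hw i (h ▸ hij.symm)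
  exact ⟨i, j, hij, by simpa [Finsupp.single_apply, hwi] using hi,
    by simpa [Finsupp.single_apply, hwj] using hj⟩

/-- If the neighbors of `w` cover all edges, then the colon ideal of the edge ideal by `x_w` is
generated by these neighbors. -/
theorem X_mul_mem_edgeIdeal_iff {G : SimpleGraph V} {w : V}
    (hw : ∀ a b, G.Adj a b → G.Adj w a ∨ G.Adj w b) (f : MvPolynomial V k) :
    X w * f ∈ edgeIdeal k G ↔ f ∈ varIdeal k {a | G.Adj w a} := by
  constructor
  · rw [mem_edgeIdeal, mem_varIdeal]
    intro hf m hm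
    obtain ⟨i, j, hij, hi, hj⟩ := hf _ (add_single_mem_support hm)
    obtain h | h := hw i j hij
    · exact ⟨i, h, by simpa [Finsupp.single_apply, h.ne] using hi⟩
    · exact ⟨j, h, by simpa [Finsupp.single_apply, h.ne] using hj⟩
  · have : varIdeal k {a | G.Adj w a} ≤
        Submodule.comap (LinearMap.mulLeft (MvPolynomial V k) (X w)) (edgeIdeal k G) := by
      refine Ideal.span_le.mpr ?_
      rintro _ ⟨a, ha, rfl⟩
      exact X_mul_X_mem_edgeIdeal ha
    exact fun hf => this hf

/-- Generators from edges at `w` vanish modulo `X w`. The graph `H` keeps `w` as an isolated vertex,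
so the polynomial ring does not change. -/
theorem edgeIdeal_sup_span_X {G H : SimpleGraph V} {w : V}
    (hH : ∀ a b, H.Adj a b ↔ G.Adj a b ∧ a ≠ w ∧ b ≠ w) :
    edgeIdeal k G ⊔ Ideal.span {X w} = edgeIdeal k H ⊔ Ideal.span {X w} := by
  have hX : (X w : MvPolynomial V k) ∈ edgeIdeal k H ⊔ Ideal.span {X w} :=
    Submodule.mem_sup_right (Ideal.mem_span_singleton_self _)
  refine le_antisymm (sup_le (Ideal.span_le.mpr ?_) le_sup_right) (sup_le_sup_right ?_ _)
  · rintro _ ⟨i, j, h, rfl⟩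
    by_cases hi : i = w
    · exact hi ▸ Ideal.mul_mem_right _ _ (hi ▸ hX)
    by_cases hj : j = w
    · exact hj ▸ Ideal.mul_mem_left _ _ (hj ▸ hX)
    exact Submodule.mem_sup_left (X_mul_X_mem_edgeIdeal ((hH i j).mpr ⟨h, hi, hj⟩))
  · refine Ideal.span_mono ?_
    rintro _ ⟨i, j, h, rfl⟩
    exact ⟨i, j, ((hH i j).mp h).1, rfl⟩

/-- The colon sequence for `X w`: the left term is the quotient by the variables in `N`. On the
right, `X w` is regular on `k[H]`, since `w` is isolated in `H`, so the bound rises by one. -/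
theorem PdLT.edgeRing_of_cover {G H : SimpleGraph V} {w : V}
    (hw : ∀ a b, G.Adj a b → G.Adj w a ∨ G.Adj w b)
    (hH : ∀ a b, H.Adj a b ↔ G.Adj a b ∧ a ≠ w ∧ b ≠ w) {N : Finset V}
    (hN : ∀ a, a ∈ N ↔ G.Adj w a) {n : ℕ} (hn : N.card ≤ n)
    (h : PdLT (MvPolynomial V k) (EdgeRing k H) n) :
    PdLT (MvPolynomial V k) (EdgeRing k G) (n + 1) := by
  have hNw : (N : Set V) = {a | G.Adj w a} := by
    ext a
    simpa using hN a
  refine PdLT.of_colon (X_mul_mem_edgeIdeal_iff hw) ?_ ?_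
  · rw [← hNw]
    exact (pdLT_quotient_varIdeal N).mono (by omega)
  · rw [edgeIdeal_sup_span_X hH]
    exact PdLT.sup_span_singleton
      (fun f => mem_edgeIdeal_of_X_mul_mem fun a ha => ((hH _ _).mp ha).2.1 rfl) h

end MonomialIdeals

/-! ### Graphs with at most four non-isolated vertices -/

section SmallGraphs

variable {V : Type v}

/-- `G` has no induced perfect matching on four vertices. -/
def TwoEdgeFree (G : SimpleGraph V) : Prop :=
  ∀ a b c d, G.Adj a b → G.Adj c d → G.Adj a c ∨ G.Adj a d ∨ G.Adj b c ∨ G.Adj b d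

/-- `G` has no induced 4-cycle. -/
def FourCycleFree (G : SimpleGraph V) : Prop :=
  ∀ a b c d, G.Adj a b → G.Adj b c → G.Adj c d → G.Adj d a → a ≠ c → b ≠ d →
    G.Adj a c ∨ G.Adj b d

/-- All vertices of `G` have degree at most `n`. -/
def DegreeLE (G : SimpleGraph V) (n : ℕ) : Prop :=
  ∀ w (N : Finset V), (∀ a ∈ N, G.Adj w a) → N.card ≤ n

/-- If an edge `ab` misses `N`, then `w, a, b` are three vertices of `T` outside `N`, so the maximal
degree is 1. The edges at `w` and `ab` are then disjoint with no edge between them, against `h2`. -/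
theorem covers_of_maximal_degree [DecidableEq V] {G : SimpleGraph V} (h2 : TwoEdgeFree G)
    {T : Finset V} (hT : ∀ a b, G.Adj a b → a ∈ T) (hT4 : T.card ≤ 4) {w : V} {N : Finset V}
    (hN : ∀ a, a ∈ N ↔ G.Adj w a) (hpos : N.Nonempty) (hdeg : DegreeLE G N.card) (a b : V)
    (hab : G.Adj a b) : G.Adj w a ∨ G.Adj w b := by
  by_contra! h
  obtain ⟨ha, hb⟩ := h
  obtain ⟨c, hc⟩ := hpos
  have hwc := (hN c).mp hc
  have hwa : w ≠ a := by rintro rfl; exact hb hab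
  have hwb : w ≠ b := by rintro rfl; exact ha hab.symm
  have hNT : N ⊆ T \ {w, a, b} := by
    intro x hx
    have hx' := (hN x).mp hx
    simp only [Finset.mem_sdiff, Finset.mem_insert, Finset.mem_singleton, not_or]
    refine ⟨hT x w hx'.symm, hx'.ne', ?_, ?_⟩
    · rintro rfl; exact ha hx'
    · rintro rfl; exact hb hx'
  have hsub : ({w, a, b} : Finset V) ⊆ T := by
    intro x hx
    simp only [Finset.mem_insert, Finset.mem_singleton] at hx
    obtain rfl | rfl | rfl := hx
    exacts [hT _ _ hwc, hT _ _ hab, hT _ _ hab.symm]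
  have hN1 : N.card ≤ 1 := by
    have h1 := Finset.card_le_card hNT
    rw [Finset.card_sdiff_of_subset hsub, Finset.card_eq_three.mpr ⟨w, a, b, hwa, hwb, hab.ne, rfl⟩]
      at h1
    omega
  have hcard : ∀ x, G.Adj c x → x = w := fun x hx => by
    by_contra hxw
    have := hdeg c {x, w} (by
      intro y hy
      simp only [Finset.mem_insert, Finset.mem_singleton] at hy
      obtain rfl | rfl := hy
      exacts [hx, hwc.symm])
    rw [Finset.card_pair hxw] at this
    omega
  obtain h | h | h | h := h2 w c a b hwc hab
  exacts [ha h, hb h, hwa (hcard a h).symm, hwb (hcard b h).symm]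

/-- A vertex `u` keeping `deg w` neighbors after the deletion is not adjacent to `w`, by maximality.
So these neighbors and `N` both lie in `T \ {u, w}`, which has at most two elements: size 1
contradicts `h2`, size 2 produces a 4-cycle. -/
theorem degreeLE_of_deleted [DecidableEq V] {G H : SimpleGraph V} (h2 : TwoEdgeFree G)
    (h4 : FourCycleFree G) {T : Finset V} (hT : ∀ a b, G.Adj a b → a ∈ T) (hT4 : T.card ≤ 4)
    {w : V} {N : Finset V} (hN : ∀ a, a ∈ N ↔ G.Adj w a) {n : ℕ} (hNn : N.card = n + 1)
    (hdeg : DegreeLE G N.card) (hH : ∀ a b, H.Adj a b ↔ G.Adj a b ∧ a ≠ w ∧ b ≠ w) :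
    DegreeLE H n := by
  intro u M hM
  by_contra! hlt
  obtain ⟨x, hx⟩ : M.Nonempty := Finset.card_pos.mp (by omega)
  have hux := (hH _ _).mp (hM x hx)
  have huw : ¬ G.Adj u w := by
    intro h
    have hwM : w ∉ M := fun hw => ((hH _ _).mp (hM w hw)).2.2 rfl
    have := hdeg u (insert w M) (by
      intro y hy
      obtain rfl | hy := Finset.mem_insert.mp hy
      exacts [h, ((hH _ _).mp (hM y hy)).1])
    rw [Finset.card_insert_of_notMem hwM] at this
    omega
  obtain ⟨z, hz⟩ : N.Nonempty := Finset.card_pos.mp (by omega)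
  have hwz := (hN z).mp hz
  have hsub : ({u, w} : Finset V) ⊆ T := by
    intro y hy
    simp only [Finset.mem_insert, Finset.mem_singleton] at hy
    obtain rfl | rfl := hy
    exacts [hT _ _ hux.1, hT _ _ hwz]
  have hR : (T \ {u, w}).card ≤ 2 := by
    rw [Finset.card_sdiff_of_subset hsub, Finset.card_pair hux.2.1]
    omega
  have hNR : N ⊆ T \ {u, w} := by
    intro y hy
    have hy' := (hN y).mp hy
    simp only [Finset.mem_sdiff, Finset.mem_insert, Finset.mem_singleton, not_or]
    refine ⟨hT y w hy'.symm, ?_, hy'.ne'⟩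
    rintro rfl; exact huw hy'.symm
  have hMR : M ⊆ T \ {u, w} := by
    intro y hy
    obtain ⟨hy', -, hyw⟩ := (hH _ _).mp (hM y hy)
    simp only [Finset.mem_sdiff, Finset.mem_insert, Finset.mem_singleton, not_or]
    exact ⟨hT y u hy'.symm, hy'.ne', hyw⟩
  have hNle := Finset.card_le_card hNR
  have two {c y₁ y₂ : V} (h₁ : G.Adj c y₁) (h₂ : G.Adj c y₂) (hy : y₁ ≠ y₂) : 2 ≤ N.card := by
    rw [← Finset.card_pair hy]
    refine hdeg c _ ?_
    intro y hy
    simp only [Finset.mem_insert, Finset.mem_singleton] at hy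
    obtain rfl | rfl := hy <;> assumption
  obtain hN1 | hN2 : N.card = 1 ∨ N.card = 2 := by omega
  · have hxz : x ≠ z := by
      rintro rfl
      have := two hux.1.symm hwz.symm hux.2.1
      omega
    obtain h | h | h | h := h2 u x w z hux.1 hwz
    · exact huw h
    · have := two h.symm hwz.symm hux.2.1
      omega
    · have := two hux.1.symm h hux.2.1
      omega
    · have := two hux.1.symm h (by rintro rfl; exact huw hwz.symm)
      omega
  · have hNT := Finset.eq_of_subset_of_card_le hNR (by omega)
    have hMT := Finset.eq_of_subset_of_card_le hMR (by omega)
    -- Now `u, a, w, b` is a 4-cycle. The chord `uw` is excluded, and the chord `ab` would give `a`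
    -- degree 3, above the maximum 2.
    obtain ⟨a, b, hab, hNab⟩ := Finset.card_eq_two.mp hN2
    have hwa := (hN a).mp (by simp [hNab])
    have hwb := (hN b).mp (by simp [hNab])
    have hua := ((hH _ _).mp (hM a (by simp [hMT, ← hNT, hNab]))).1
    have hub := ((hH _ _).mp (hM b (by simp [hMT, ← hNT, hNab]))).1
    obtain h | h := h4 u a w b hua hwa.symm hwb hub.symm hux.2.1 hab
    · exact huw h
    · have := hdeg a {u, w, b} (by
        intro y hy
        simp only [Finset.mem_insert, Finset.mem_singleton] at hy
        obtain rfl | rfl | rfl := hy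
        exacts [hua.symm, hwa.symm, h])
      rw [Finset.card_eq_three.mpr ⟨u, w, b, hux.2.1, hub.ne, hwb.ne, rfl⟩] at this
      omega

theorem edgeIdeal_eq_bot {k : Type u} [Field k] {G : SimpleGraph V} (h : ∀ a b, ¬ G.Adj a b) :
    edgeIdeal k G = ⊥ := by
  rw [edgeIdeal, Ideal.span_eq_bot]
  rintro _ ⟨i, j, hij, -⟩
  exact absurd hij (h i j)

theorem pdLT_edgeRing_of_isEmpty_edges {k : Type u} [Field k] {G : SimpleGraph V}
    (h : ∀ a b, ¬ G.Adj a b) : PdLT (MvPolynomial V k) (EdgeRing k G) 1 := by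
  exact PdLT.of_equiv (pdLT_one_iff.mpr inferInstance)
    (Submodule.quotEquivOfEqBot _ (edgeIdeal_eq_bot h)).symm

/-- The induction is on a set `T` containing all non-isolated vertices, not on `V`: deleting `w`
shrinks `T` while the ring stays fixed. -/
theorem pdLT_edgeRing_of_degreeLE [Fintype V] (k : Type u) [Field k] (t : ℕ) :
    ∀ (G : SimpleGraph V) (T : Finset V), T.card = t → T.card ≤ 4 →
      (∀ a b, G.Adj a b → a ∈ T) → TwoEdgeFree G → FourCycleFree G → ∀ D, DegreeLE G D →
        PdLT (MvPolynomial V k) (EdgeRing k G) (D + 1) := by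
  classical
  induction t with
  | zero =>
    intro G T hTc _ hT _ _ D _
    rw [Finset.card_eq_zero] at hTc
    subst hTc
    exact (pdLT_edgeRing_of_isEmpty_edges fun a b h => by simpa using hT a b h).mono (by omega)
  | succ t ih =>
    intro G T hTc hT4 hT h2 h4 D hD
    by_cases hedge : ∀ a b, ¬ G.Adj a b
    · exact (pdLT_edgeRing_of_isEmpty_edges hedge).mono (by omega)
    push Not at hedge
    obtain ⟨p, q, hpq⟩ := hedge
    have : Nonempty V := ⟨p⟩
    obtain ⟨w, hw⟩ := G.exists_maximal_degree_vertex
    have hN : ∀ a, a ∈ G.neighborFinset w ↔ G.Adj w a := fun a => G.mem_neighborFinset w a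
    have hdeg : DegreeLE G (G.neighborFinset w).card := by
      intro c M hM
      rw [SimpleGraph.card_neighborFinset_eq_degree, ← hw]
      refine le_trans ?_ (G.degree_le_maxDegree c)
      rw [← SimpleGraph.card_neighborFinset_eq_degree]
      exact Finset.card_le_card fun y hy => (G.mem_neighborFinset c y).mpr (hM y hy)
    have hpos : (G.neighborFinset w).Nonempty := by
      have := hdeg p {q} (by simpa using hpq)
      exact Finset.card_pos.mp (by rwa [Finset.card_singleton] at this)
    obtain ⟨n, hn⟩ : ∃ n, (G.neighborFinset w).card = n + 1 :=
      Nat.exists_eq_succ_of_ne_zero (Finset.card_pos.mpr hpos).ne'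
    let H : SimpleGraph V :=
      { Adj := fun a b => G.Adj a b ∧ a ≠ w ∧ b ≠ w
        symm := ⟨fun a b h => ⟨h.1.symm, h.2.2, h.2.1⟩⟩
        loopless := ⟨fun a h => h.1.ne rfl⟩ }
    have hH : ∀ a b, H.Adj a b ↔ G.Adj a b ∧ a ≠ w ∧ b ≠ w := fun _ _ => Iff.rfl
    have hwT : w ∈ T := by
      obtain ⟨c, hc⟩ := hpos
      exact hT w c ((hN c).mp hc)
    have hHpd := ih H (T.erase w) (by rw [Finset.card_erase_of_mem hwT]; omega)
      (by rw [Finset.card_erase_of_mem hwT]; omega)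
      (fun a b h => Finset.mem_erase.mpr ⟨h.2.1, hT a b h.1⟩)
      (fun a b c d hab hcd => by
        have := h2 a b c d hab.1 hcd.1
        have := hab.2
        have := hcd.2
        simp only [hH]
        tauto)
      (fun a b c d hab hbc hcd hda hac hbd => by
        have := h4 a b c d hab.1 hbc.1 hcd.1 hda.1 hac hbd
        have := hab.2
        have := hcd.2
        simp only [hH]
        tauto) n
      (degreeLE_of_deleted h2 h4 hT hT4 hN hn hdeg hH)
    refine (PdLT.edgeRing_of_cover (covers_of_maximal_degree h2 hT hT4 hN hpos hdeg) hH hN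
      hn.le hHpd).mono ?_
    have := hD w (G.neighborFinset w) fun a ha => (hN a).mp ha
    omega

end SmallGraphs

/-! ### Two disjoint edges have no linear resolution -/

section LinearResolutions

open MvPolynomial

variable {V : Type v} {k : Type u} [Field k]

theorem X_mul_X_eq_monomial (a b : V) :
    (X a * X b : MvPolynomial V k) = monomial (Finsupp.single a 1 + Finsupp.single b 1) 1 := by
  simp [X, monomial_mul]

theorem eq_single_add_single_of_degree {a b : V} {m : V →₀ ℕ} (hm : m.degree = 2)
    (hle : Finsupp.single a 1 + Finsupp.single b 1 ≤ m) :
    Finsupp.single a 1 + Finsupp.single b 1 = m := by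
  obtain ⟨r, rfl⟩ := exists_add_of_le hle
  have hr : r.degree = 0 := by
    simp only [map_add, Finsupp.degree_single] at hm
    omega
  rw [(Finsupp.degree_eq_zero_iff r).mp hr, add_zero]

/-- The edge ideal of a graph with just two edges, without common vertices, has no linear
resolution: the syzygy between the two generators has degree four. -/
theorem not_hasTwoLinearResolution_of_disjoint_edges {G : SimpleGraph V} {a b c d : V}
    (hac : a ≠ c) (had : a ≠ d) (hbc : b ≠ c) (hbd : b ≠ d) (hcd' : c ≠ d)
    (hab : G.Adj a b) (hcd : G.Adj c d)
    (hG : ∀ i j, G.Adj i j → s(i, j) = s(a, b) ∨ s(i, j) = s(c, d)) :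
    ¬ HasTwoLinearResolution (edgeIdeal k G) := by
  classical
  rintro ⟨n, ε, δ, -, hε, hδ, hrange, hexact, -⟩
  set μ : V →₀ ℕ := Finsupp.single a 1 + Finsupp.single b 1 with hμ
  set ν : V →₀ ℕ := Finsupp.single c 1 + Finsupp.single d 1 with hν
  have hνμ : ∀ m : V →₀ ℕ, ν ≤ m + μ → m c ≠ 0 ∧ m d ≠ 0 := by
    intro m h
    have := (single_add_single_le_iff hcd' _).mp h
    simpa [hμ, Finsupp.single_apply, hac, had, hbc, hbd] using this
  have hμν : ¬ μ ≤ ν := by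
    intro h
    have := ((single_add_single_le_iff hab.ne _).mp h).1
    simp [hν, hac.symm, had.symm] at this
  have hνμ0 : ¬ ν ≤ μ := fun h => by simpa using hνμ 0 (by simpa using h)
  have hp : (X a * X b : MvPolynomial V k) = monomial μ 1 := X_mul_X_eq_monomial a b
  have hq : (X c * X d : MvPolynomial V k) = monomial ν 1 := X_mul_X_eq_monomial c d
  -- A quadratic form in the ideal is a scalar combination of the two edge monomials, the only
  -- monomials of degree 2 in it.
  have hQ : ∀ t, ε (Pi.single t 1) =
      C (coeff μ (ε (Pi.single t 1))) * monomial μ 1 +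
        C (coeff ν (ε (Pi.single t 1))) * monomial ν 1 := by
    intro t
    have hmem : ε (Pi.single t 1) ∈ edgeIdeal k G := hrange ▸ LinearMap.mem_range_self ε _
    ext m
    rw [coeff_add, coeff_C_mul, coeff_C_mul, coeff_monomial, coeff_monomial]
    by_cases hm1 : μ = m
    · subst hm1
      simp [show ν ≠ μ from fun h => hνμ0 h.le]
    by_cases hm2 : ν = m
    · subst hm2
      simp [show μ ≠ ν from fun h => hμν h.le]
    rw [if_neg hm1, if_neg hm2, mul_zero, mul_zero, add_zero]
    by_contra hne
    have hdeg : m.degree = 2 := by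
      have : Finsupp.weight 1 m = 2 := hε t hne
      rwa [Finsupp.degree_eq_weight_one]
    obtain ⟨i, j, hij, hi, hj⟩ := mem_edgeIdeal.mp hmem m (mem_support_iff.mpr hne)
    obtain h | h := hG i j hij
    · refine hm1 (eq_single_add_single_of_degree hdeg
        ((single_add_single_le_iff hab.ne m).mpr ?_))
      obtain ⟨rfl, rfl⟩ | ⟨rfl, rfl⟩ := Sym2.eq_iff.mp h
      exacts [⟨hi, hj⟩, ⟨hj, hi⟩]
    · refine hm2 (eq_single_add_single_of_degree hdeg
        ((single_add_single_le_iff hcd' m).mpr ?_))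
      obtain ⟨rfl, rfl⟩ | ⟨rfl, rfl⟩ := Sym2.eq_iff.mp h
      exacts [⟨hi, hj⟩, ⟨hj, hi⟩]
  let A := Fintype.linearCombination (MvPolynomial V k)
    fun t => (C (coeff μ (ε (Pi.single t 1))) : MvPolynomial V k)
  let B := Fintype.linearCombination (MvPolynomial V k)
    fun t => (C (coeff ν (ε (Pi.single t 1))) : MvPolynomial V k)
  have hAB : ∀ f, ε f = A f * monomial μ 1 + B f * monomial ν 1 := by
    intro f
    rw [LinearMap.pi_apply_eq_sum_univ ε f]
    simp only [A, B, Fintype.linearCombination_apply, Finset.sum_mul, ← Finset.sum_add_distrib]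
    refine Finset.sum_congr rfl fun t _ => ?_
    have : (fun j => if t = j then (1 : MvPolynomial V k) else 0) = Pi.single t 1 := by
      ext1 j
      simp [Pi.single_apply, eq_comm]
    rw [this]
    conv_lhs => rw [hQ t]
    simp only [smul_eq_mul]
    ring
  -- On a column of `δ 0`, `A` is a linear form, and `A μ + B ν = 0`. As the two monomials are
  -- coprime, the quadric `ν` divides `A`, so `A = 0`.
  have hrow : ∀ s, A (δ 0 (Pi.single s 1)) = 0 := by
    intro s
    have hhom : (A (δ 0 (Pi.single s 1))).IsHomogeneous 1 := by
      simp only [A, Fintype.linearCombination_apply]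
      exact IsHomogeneous.sum _ _ _ fun t _ => (hδ 0 s t).mul (isHomogeneous_C _ _)
    have hz := (hexact (δ 0 (Pi.single s 1))).mpr ⟨_, rfl⟩
    rw [hAB] at hz
    ext m
    by_contra hne
    rw [coeff_zero] at hne
    have hdeg : m.degree = 1 := by
      have : Finsupp.weight 1 m = 1 := hhom hne
      rwa [Finsupp.degree_eq_weight_one]
    have hc := congrArg (coeff (m + μ)) hz
    rw [coeff_add, coeff_mul_monomial, coeff_mul_monomial', coeff_zero, mul_one] at hc
    split_ifs at hc with hle
    · have h2 : ν ≤ m := (single_add_single_le_iff hcd' m).mpr (hνμ m hle)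
      obtain ⟨r, rfl⟩ := exists_add_of_le h2
      simp only [hν, map_add, Finsupp.degree_single] at hdeg
      omega
    · exact hne (by simpa using hc)
  obtain ⟨f, hf⟩ : monomial μ 1 ∈ LinearMap.range ε := by
    rw [hrange, ← hp]
    exact X_mul_X_mem_edgeIdeal hab
  obtain ⟨g, hg⟩ : monomial ν 1 ∈ LinearMap.range ε := by
    rw [hrange, ← hq]
    exact X_mul_X_mem_edgeIdeal hcd
  have hf0 : coeff 0 (A f) = 1 := by
    have := congrArg (coeff μ) ((hAB f).symm.trans hf)
    simpa [coeff_mul_monomial', hνμ0] using this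
  -- The Koszul syzygy `ν f - μ g` must be a combination of columns, so `A` vanishes on it. But `A
  -- f` has constant term 1, so the coefficient at `ν` is 1.
  obtain ⟨e, he⟩ := (hexact (monomial ν (1 : k) • f - monomial μ (1 : k) • g)).mp (by
    rw [map_sub, map_smul, map_smul, hf, hg, smul_eq_mul, smul_eq_mul, mul_comm, sub_self])
  have hAe : A (δ 0 e) = 0 := by
    have : A ∘ₗ δ 0 = 0 := by
      refine LinearMap.pi_ext' fun s => LinearMap.ext_ring ?_
      simpa using hrow s
    exact LinearMap.congr_fun this e
  rw [he, map_sub, map_smul, map_smul] at hAe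
  have := congrArg (coeff ν) hAe
  rw [coeff_sub, smul_eq_mul, smul_eq_mul, mul_comm, mul_comm (monomial μ 1), coeff_mul_monomial',
    coeff_mul_monomial', if_pos le_rfl, if_neg hμν, tsub_self, hf0] at this
  simp at this

end LinearResolutions

/-! ### The 4-cycle: projective dimension and linear resolution -/

section FourCycle

open MvPolynomial

variable {k : Type u} [Field k]

theorem fourCycle_adj_iff (i j : Fin 4) :
    fourCycle.Adj i j ↔ (i ∈ ({0, 1} : Set (Fin 4)) ∧ j ∈ ({2, 3} : Set (Fin 4))) ∨
      (i ∈ ({2, 3} : Set (Fin 4)) ∧ j ∈ ({0, 1} : Set (Fin 4))) := by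
  simp only [Set.mem_insert_iff, Set.mem_singleton_iff]
  revert i j
  decide

/-- C₄ is complete bipartite with sides `{0, 1}` and `{2, 3}`: a monomial is divisible by an edge
exactly when it involves both sides. -/
theorem mem_edgeIdeal_fourCycle {f : MvPolynomial (Fin 4) k} :
    f ∈ edgeIdeal k fourCycle ↔ f ∈ varIdeal k {0, 1} ∧ f ∈ varIdeal k {2, 3} := by
  simp only [mem_edgeIdeal, mem_varIdeal, fourCycle_adj_iff]
  constructor
  · intro h
    refine ⟨fun m hm => ?_, fun m hm => ?_⟩ <;>
    · obtain ⟨i, j, ⟨hi, hj⟩ | ⟨hi, hj⟩, hmi, hmj⟩ := h m hm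
      first | exact ⟨i, hi, hmi⟩ | exact ⟨j, hj, hmj⟩
      first | exact ⟨i, hi, hmi⟩ | exact ⟨j, hj, hmj⟩
  · rintro ⟨h1, h2⟩ m hm
    obtain ⟨i, hi, hmi⟩ := h1 m hm
    obtain ⟨j, hj, hmj⟩ := h2 m hm
    exact ⟨i, j, Or.inl ⟨hi, hj⟩, hmi, hmj⟩

/-- In `0 → S/I → S/P ⊕ S/Q → S/(P + Q) → 0` the middle has `pd ≤ 2`. If `pd S/I < 3`, then `pd S/(P
+ Q) < 4`, but in this quotient the nonzero class of 1 is killed by all four variables. -/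
theorem not_pdLT_edgeRing_fourCycle :
    ¬ PdLT (MvPolynomial (Fin 4) k) (EdgeRing k fourCycle) 3 := by
  intro h
  set P : Ideal (MvPolynomial (Fin 4) k) := varIdeal k {0, 1}
  set Q : Ideal (MvPolynomial (Fin 4) k) := varIdeal k {2, 3}
  have hIP : edgeIdeal k fourCycle ≤ P := fun f hf => (mem_edgeIdeal_fourCycle.mp hf).1
  have hIQ : edgeIdeal k fourCycle ≤ Q := fun f hf => (mem_edgeIdeal_fourCycle.mp hf).2
  have hP : PdLT (MvPolynomial (Fin 4) k) (MvPolynomial (Fin 4) k ⧸ P) 3 := by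
    have := pdLT_quotient_varIdeal (k := k) ({0, 1} : Finset (Fin 4))
    rw [Finset.coe_pair] at this
    exact this.mono (by decide)
  have hQ : PdLT (MvPolynomial (Fin 4) k) (MvPolynomial (Fin 4) k ⧸ Q) 3 := by
    have := pdLT_quotient_varIdeal (k := k) ({2, 3} : Finset (Fin 4))
    rw [Finset.coe_pair] at this
    exact this.mono (by decide)
  have hW : PdLT (MvPolynomial (Fin 4) k) (MvPolynomial (Fin 4) k ⧸ (P ⊔ Q)) 4 := by
    refine PdLT.right
      (f := (Submodule.factor hIP).prod (Submodule.factor hIQ))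
      (g := (Submodule.factor (le_sup_left : P ≤ P ⊔ Q)).coprod
        (-Submodule.factor (le_sup_right : Q ≤ P ⊔ Q)))
      ?_ ?_ ?_ h ((hP.prod hQ).mono (by omega))
    · refine (injective_iff_map_eq_zero _).mpr fun f hf => ?_
      obtain ⟨f, rfl⟩ := Submodule.Quotient.mk_surjective _ f
      obtain ⟨h1, h2⟩ := Prod.mk.inj hf
      exact (Submodule.Quotient.mk_eq_zero _).mpr (mem_edgeIdeal_fourCycle.mpr
        ⟨(Submodule.Quotient.mk_eq_zero _).mp h1, (Submodule.Quotient.mk_eq_zero _).mp h2⟩)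
    · rintro ⟨f, g⟩
      obtain ⟨f, rfl⟩ := Submodule.Quotient.mk_surjective _ f
      obtain ⟨g, rfl⟩ := Submodule.Quotient.mk_surjective _ g
      rw [LinearMap.coprod_apply, LinearMap.neg_apply, ← sub_eq_add_neg]
      change Submodule.Quotient.mk f - Submodule.Quotient.mk g = 0 ↔ _
      rw [sub_eq_zero, Submodule.Quotient.eq, Submodule.mem_sup]
      constructor
      · rintro ⟨y, hy, z, hz, hyz⟩
        refine ⟨Submodule.Quotient.mk (f - y), Prod.ext ?_ ?_⟩
        · change Submodule.Quotient.mk (f - y) = Submodule.Quotient.mk f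
          rw [Submodule.Quotient.eq, sub_sub_cancel_left]
          exact neg_mem hy
        · change Submodule.Quotient.mk (f - y) = Submodule.Quotient.mk g
          rw [Submodule.Quotient.eq, show f - y - g = z by rw [sub_right_comm, ← hyz]; ring]
          exact hz
      · rintro ⟨e, he⟩
        obtain ⟨e, rfl⟩ := Submodule.Quotient.mk_surjective _ e
        obtain ⟨h1, h2⟩ := Prod.mk.inj he
        have h1 : e - f ∈ P := (Submodule.Quotient.eq _).mp h1
        have h2 : e - g ∈ Q := (Submodule.Quotient.eq _).mp h2
        exact ⟨-(e - f), neg_mem h1, e - g, h2, by ring⟩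
    · intro f
      obtain ⟨f, rfl⟩ := Submodule.Quotient.mk_surjective _ f
      exact ⟨(Submodule.Quotient.mk f, 0), by simp⟩
  have hPQ : P ⊔ Q = varIdeal k ((Finset.univ : Finset (Fin 4)) : Set (Fin 4)) := by
    simp only [P, Q, varIdeal]
    rw [← Ideal.span_union, ← Set.image_union]
    congr 2
    ext i
    simp only [Set.mem_union, Set.mem_insert_iff, Set.mem_singleton_iff, Finset.coe_univ,
      Set.mem_univ, iff_true]
    revert i
    decide
  rw [hPQ] at hW
  refine not_pdLT_card (f := 1) (fun h1 => ?_) Finset.univ (fun w hw => ?_) hW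
  · obtain ⟨i, -, hi⟩ := mem_varIdeal.mp h1 0 (by simp)
    simp at hi
  · rw [mul_one]
    exact X_mem_varIdeal hw

/-- Deleting the vertex 0 leaves the path `2 - 1 - 3`, still of maximal degree 2, so `pd ≤ 2` there
and the colon sequence adds one. The failure of the degree to drop is what makes C₄ exceptional. -/
theorem pdLT_edgeRing_fourCycle :
    PdLT (MvPolynomial (Fin 4) k) (EdgeRing k fourCycle) 4 := by
  let H : SimpleGraph (Fin 4) :=
    { Adj := fun a b => fourCycle.Adj a b ∧ a ≠ 0 ∧ b ≠ 0
      symm := ⟨fun a b h => ⟨h.1.symm, h.2.2, h.2.1⟩⟩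
      loopless := ⟨fun a h => h.1.ne rfl⟩ }
  refine PdLT.edgeRing_of_cover (G := fourCycle) (H := H) (w := 0) (N := {2, 3}) (n := 3)
    (by decide) (fun _ _ => Iff.rfl) (by decide) (by decide) ?_
  refine pdLT_edgeRing_of_degreeLE k 3 H {1, 2, 3} rfl (by decide) ?_ ?_ ?_ 2 ?_
  · change ∀ a b : Fin 4, fourCycle.Adj a b ∧ a ≠ 0 ∧ b ≠ 0 → _
    decide
  · change ∀ a b c d : Fin 4, fourCycle.Adj a b ∧ a ≠ 0 ∧ b ≠ 0 →
      fourCycle.Adj c d ∧ c ≠ 0 ∧ d ≠ 0 →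
      (fourCycle.Adj a c ∧ a ≠ 0 ∧ c ≠ 0) ∨ (fourCycle.Adj a d ∧ a ≠ 0 ∧ d ≠ 0) ∨
      (fourCycle.Adj b c ∧ b ≠ 0 ∧ c ≠ 0) ∨ (fourCycle.Adj b d ∧ b ≠ 0 ∧ d ≠ 0)
    decide
  -- Only 1, 2, 3 carry edges of `H`, too few for four distinct vertices.
  · intro a b c d hab hbc hcd hda hac hbd
    have := hab.2.1
    have := hcd.2
    have := hab.2.2
    have := hab.1.ne
    have := hbc.1.ne
    have := hcd.1.ne
    have := hda.1.ne
    omega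
  · intro w N hN
    refine (Finset.card_le_card (t := fourCycle.neighborFinset w) fun x hx => ?_).trans ?_
    · exact (fourCycle.mem_neighborFinset w x).mpr (hN x hx).1
    · clear hN
      revert w
      decide

/-- The ranks of the free modules in the linear resolution of `I(C₄)`. -/
def fourCycleBetti : ℕ → ℕ
  | 0 => 4
  | 1 => 4
  | 2 => 1
  | _ + 3 => 0

/-- The generators of `I(C₄)`, as a linear map. -/
noncomputable def fourCycleGenerators (k : Type u) [Field k] :
    (Fin 4 → MvPolynomial (Fin 4) k) →ₗ[MvPolynomial (Fin 4) k] MvPolynomial (Fin 4) k :=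
  Fintype.linearCombination _ ![X 0 * X 2, X 0 * X 3, X 1 * X 2, X 1 * X 3]

/-- The first syzygies of `I(C₄)`. -/
noncomputable def fourCycleSyzygies (k : Type u) [Field k] :
    (Fin 4 → MvPolynomial (Fin 4) k) →ₗ[MvPolynomial (Fin 4) k] (Fin 4 → MvPolynomial (Fin 4) k) :=
  Fintype.linearCombination _
    ![![X 3, -X 2, 0, 0], ![0, 0, X 3, -X 2], ![X 1, 0, -X 0, 0], ![0, X 1, 0, -X 0]]

/-- The second syzygies of `I(C₄)`. -/
noncomputable def fourCycleSecondSyzygies (k : Type u) [Field k] :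
    (Fin 1 → MvPolynomial (Fin 4) k) →ₗ[MvPolynomial (Fin 4) k] (Fin 4 → MvPolynomial (Fin 4) k) :=
  Fintype.linearCombination _ ![![X 1, -X 0, -X 3, X 2]]

/-- The differentials of the linear resolution of `I(C₄)`. -/
noncomputable def fourCycleDifferential (k : Type u) [Field k] : ∀ i : ℕ,
    (Fin (fourCycleBetti (i + 1)) → MvPolynomial (Fin 4) k) →ₗ[MvPolynomial (Fin 4) k]
      (Fin (fourCycleBetti i) → MvPolynomial (Fin 4) k)
  | 0 => fourCycleSyzygies k
  | 1 => fourCycleSecondSyzygies k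
  | _ + 2 => 0

theorem fourCycleGenerators_apply (f : Fin 4 → MvPolynomial (Fin 4) k) :
    fourCycleGenerators k f =
      f 0 * (X 0 * X 2) + f 1 * (X 0 * X 3) + f 2 * (X 1 * X 2) + f 3 * (X 1 * X 3) := by
  simp [fourCycleGenerators, Fintype.linearCombination_apply, Fin.sum_univ_four]

theorem fourCycleSyzygies_apply (f : Fin 4 → MvPolynomial (Fin 4) k) :
    fourCycleSyzygies k f = ![f 0 * X 3 + f 2 * X 1, f 3 * X 1 - f 0 * X 2,
      f 1 * X 3 - f 2 * X 0, -(f 1 * X 2) - f 3 * X 0] := by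
  ext1 i
  fin_cases i <;>
    simp [fourCycleSyzygies, Fintype.linearCombination_apply, Fin.sum_univ_four] <;> ring

theorem fourCycleSecondSyzygies_apply (f : Fin 1 → MvPolynomial (Fin 4) k) :
    fourCycleSecondSyzygies k f = ![f 0 * X 1, -(f 0 * X 0), -(f 0 * X 3), f 0 * X 2] := by
  ext1 i
  fin_cases i <;> simp [fourCycleSecondSyzygies, Fintype.linearCombination_apply]

theorem X_dvd_of_X_dvd_mul_X {V : Type v} {i j : V} (hij : i ≠ j) {f : MvPolynomial V k}
    (h : X i ∣ f * X j) : X i ∣ f :=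
  ((X_prime (R := k) (i := i)).dvd_or_dvd h).resolve_right fun h' => hij (by simpa using h')

/-- Since `X j` is prime and does not divide `X i`, it divides `f`; cancelling it gives `g`. -/
theorem exists_koszul_of_mul_X_add_mul_X_eq_zero {V : Type v} {i j : V} (hij : i ≠ j)
    {f g : MvPolynomial V k} (h : f * X i + g * X j = 0) :
    ∃ t, f = t * X j ∧ g = -(t * X i) := by
  obtain ⟨t, rfl⟩ := X_dvd_of_X_dvd_mul_X hij.symm (f := f)
    ⟨-g, by linear_combination h⟩
  refine ⟨t, mul_comm _ _, mul_right_cancel₀ (X_ne_zero (R := k) j) ?_⟩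
  linear_combination h

theorem range_fourCycleGenerators :
    LinearMap.range (fourCycleGenerators k) = edgeIdeal k fourCycle := by
  rw [fourCycleGenerators, Fintype.range_linearCombination]
  change Ideal.span _ = Ideal.span _
  refine le_antisymm (Ideal.span_mono ?_) (Ideal.span_mono ?_)
  · rintro _ ⟨i, rfl⟩
    fin_cases i
    exacts [⟨0, 2, by decide, rfl⟩, ⟨0, 3, by decide, rfl⟩, ⟨1, 2, by decide, rfl⟩,
      ⟨1, 3, by decide, rfl⟩]
  · rintro _ ⟨i, j, h, rfl⟩
    obtain ⟨rfl | rfl, rfl | rfl⟩ | ⟨rfl | rfl, rfl | rfl⟩ := (fourCycle_adj_iff i j).mp h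
    exacts [⟨0, rfl⟩, ⟨1, rfl⟩, ⟨2, rfl⟩, ⟨3, rfl⟩, ⟨0, mul_comm _ _⟩, ⟨2, mul_comm _ _⟩,
      ⟨1, mul_comm _ _⟩, ⟨3, mul_comm _ _⟩]

theorem exact_fourCycleSyzygies :
    Function.Exact (fourCycleSyzygies k) (fourCycleGenerators k) := by
  intro f
  constructor
  · intro h
    rw [fourCycleGenerators_apply] at h
    -- The relation is grouped as a syzygy of `X 0` and `X 1`.
    obtain ⟨h₁, hf₁, hf₂⟩ := exists_koszul_of_mul_X_add_mul_X_eq_zero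
      (show (0 : Fin 4) ≠ 1 by decide) (f := f 0 * X 2 + f 1 * X 3) (g := f 2 * X 2 + f 3 * X 3)
      (by linear_combination h)
    -- As `X 1` is regular modulo `(X 2, X 3)`, `h₁ = p X 2 + q X 3`. Subtracting the parts with `p`
    -- and `q` leaves two syzygies of `X 2` and `X 3`.
    have hmem : X 1 * h₁ ∈ varIdeal k ({2, 3} : Set (Fin 4)) := by
      rw [mul_comm, ← hf₁]
      exact add_mem (Ideal.mul_mem_left _ _ (X_mem_varIdeal (by simp)))
        (Ideal.mul_mem_left _ _ (X_mem_varIdeal (by simp)))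
    have hmem := mem_varIdeal_of_X_mul_mem (by simp) hmem
    rw [varIdeal, Set.image_pair, Ideal.mem_span_pair] at hmem
    obtain ⟨p, q, rfl⟩ := hmem
    obtain ⟨s, hs₁, hs₂⟩ := exists_koszul_of_mul_X_add_mul_X_eq_zero
      (show (2 : Fin 4) ≠ 3 by decide) (f := f 0 - p * X 1) (g := f 1 - q * X 1)
      (by linear_combination hf₁)
    obtain ⟨t, ht₁, ht₂⟩ := exists_koszul_of_mul_X_add_mul_X_eq_zero
      (show (2 : Fin 4) ≠ 3 by decide) (f := f 2 + p * X 0) (g := f 3 + q * X 0)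
      (by linear_combination hf₂)
    refine ⟨![s, t, p, q], ?_⟩
    rw [fourCycleSyzygies_apply]
    ext1 i
    fin_cases i
    · change s * X 3 + p * X 1 = f 0
      linear_combination -hs₁
    · change q * X 1 - s * X 2 = f 1
      linear_combination -hs₂
    · change t * X 3 - p * X 0 = f 2
      linear_combination -ht₁
    · change -(t * X 2) - q * X 0 = f 3
      linear_combination -ht₂
  · rintro ⟨g, rfl⟩
    rw [fourCycleGenerators_apply, fourCycleSyzygies_apply]
    simp only [Matrix.cons_val]
    ring

theorem exact_fourCycleSecondSyzygies :
    Function.Exact (fourCycleSecondSyzygies k) (fourCycleSyzygies k) := by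
  intro f
  rw [fourCycleSyzygies_apply]
  constructor
  · intro h
    have h0 : f 0 * X 3 + f 2 * X 1 = 0 := congrFun h 0
    have h1 : f 3 * X 1 - f 0 * X 2 = 0 := congrFun h 1
    have h2 : f 1 * X 3 - f 2 * X 0 = 0 := congrFun h 2
    obtain ⟨t, ht0, ht2⟩ := exists_koszul_of_mul_X_add_mul_X_eq_zero (by decide) h0
    refine ⟨![t], ?_⟩
    rw [fourCycleSecondSyzygies_apply]
    ext1 i
    fin_cases i
    · exact ht0.symm
    · refine mul_right_cancel₀ (X_ne_zero (R := k) 3) ?_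
      change -(t * X 0) * X 3 = f 1 * X 3
      linear_combination -h2 - ht2 * X 0
    · exact ht2.symm
    · refine mul_right_cancel₀ (X_ne_zero (R := k) 1) ?_
      change t * X 2 * X 1 = f 3 * X 1
      linear_combination -h1 - ht0 * X 2
  · rintro ⟨g, rfl⟩
    rw [fourCycleSecondSyzygies_apply]
    ext1 i
    fin_cases i <;> simp <;> ring

theorem fourCycleSecondSyzygies_injective : Function.Injective (fourCycleSecondSyzygies k) := by
  refine (injective_iff_map_eq_zero _).mpr fun f hf => ?_
  rw [fourCycleSecondSyzygies_apply] at hf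
  ext1 i
  rw [Subsingleton.elim i 0]
  exact (mul_eq_zero.mp (congrFun hf 0)).resolve_right (X_ne_zero (R := k) 1)

theorem isHomogeneous_neg_X {V : Type v} (i : V) : (-X i : MvPolynomial V k).IsHomogeneous 1 :=
  (isHomogeneous_X k i).neg

theorem isHomogeneous_fourCycleGenerators (s : Fin 4) :
    (fourCycleGenerators k (Pi.single s 1)).IsHomogeneous 2 := by
  rw [fourCycleGenerators, Fintype.linearCombination_apply_single, one_smul]
  fin_cases s <;> exact (isHomogeneous_X k _).mul (isHomogeneous_X k _)

theorem isHomogeneous_fourCycleSyzygies (s t : Fin 4) :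
    (fourCycleSyzygies k (Pi.single s 1) t).IsHomogeneous 1 := by
  rw [fourCycleSyzygies, Fintype.linearCombination_apply_single, one_smul]
  fin_cases s <;> fin_cases t <;>
    first
    | exact isHomogeneous_X k _
    | exact isHomogeneous_neg_X _
    | exact isHomogeneous_zero _ _ _

theorem isHomogeneous_fourCycleSecondSyzygies (s : Fin 1) (t : Fin 4) :
    (fourCycleSecondSyzygies k (Pi.single s 1) t).IsHomogeneous 1 := by
  rw [fourCycleSecondSyzygies, Fintype.linearCombination_apply_single, one_smul]
  fin_cases s
  fin_cases t <;>
    first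
    | exact isHomogeneous_X k _
    | exact isHomogeneous_neg_X _

theorem hasTwoLinearResolution_fourCycle :
    HasTwoLinearResolution (edgeIdeal k fourCycle) := by
  refine ⟨fourCycleBetti, fourCycleGenerators k, fourCycleDifferential k, ⟨3, ?_⟩,
    isHomogeneous_fourCycleGenerators, ?_, range_fourCycleGenerators, exact_fourCycleSyzygies, ?_⟩
  · intro i hi
    obtain ⟨i, rfl⟩ := Nat.exists_eq_add_of_le' hi
    rfl
  · rintro (_ | _ | i) s t
    · exact isHomogeneous_fourCycleSyzygies s t
    · exact isHomogeneous_fourCycleSecondSyzygies s t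
    · exact isHomogeneous_zero _ _ _
  · rintro (_ | i)
    · exact exact_fourCycleSecondSyzygies
    · intro f
      constructor
      · intro hf
        refine ⟨0, ?_⟩
        rw [map_zero]
        -- Exactness after the zero map is injectivity of the second syzygies; beyond that the
        -- modules have rank 0.
        obtain _ | i := i
        · exact (fourCycleSecondSyzygies_injective (hf.trans (map_zero _).symm)).symm
        · exact funext fun t : Fin 0 => t.elim0
      · rintro ⟨g, rfl⟩
        exact map_zero _

end FourCycle

/-! ### Stanley-Reisner description and classification on four vertices -/

section FourVertices

open MvPolynomial

/-- A nonempty set is a non-face of the clique complex of `Gᶜ` exactly when it contains an edge of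
`G`, so every generator on the right is a multiple of an edge monomial. -/
theorem edgeIdeal_eq_stanleyReisnerIdeal {V : Type v} [DecidableEq V] (k : Type u) [Field k]
    (G : SimpleGraph V) : edgeIdeal k G = stanleyReisnerIdeal k (largestComplex Gᶜ) := by
  refine le_antisymm (Ideal.span_mono ?_) (Ideal.span_le.mpr ?_)
  · rintro _ ⟨i, j, h, rfl⟩
    refine ⟨{i, j}, Finset.insert_nonempty _ _, fun hs => ?_, (Finset.prod_pair h.ne).symm⟩
    exact (hs.2 (by simp) (by simp) h.ne).2 h
  · rintro _ ⟨s, hs, hns, rfl⟩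
    have : ¬ Gᶜ.IsClique (s : Set V) := fun h => hns ⟨hs, h⟩
    rw [SimpleGraph.isClique_iff, Set.Pairwise] at this
    push Not at this
    obtain ⟨i, hi, j, hj, hij, hadj⟩ := this
    have hG : G.Adj i j := by
      by_contra h
      exact hadj ⟨hij, h⟩
    refine Ideal.mem_of_dvd _ ?_ (X_mul_X_mem_edgeIdeal (k := k) hG)
    rw [← Finset.prod_pair hij]
    refine Finset.prod_dvd_prod_of_subset _ _ _ fun x hx => ?_
    simp only [Finset.mem_insert, Finset.mem_singleton] at hx
    obtain rfl | rfl := hx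
    exacts [hi, hj]

theorem facets_largestComplex_compl_fourCycle :
    facets (largestComplex fourCycleᶜ) = {{0, 1}, {2, 3}} := by
  -- Listing all six nonempty faces reduces maximality to a finite check.
  have hface : ∀ s : Finset (Fin 4),
      (s.Nonempty ∧ ∀ a ∈ s, ∀ b ∈ s, a ≠ b → ¬ fourCycle.Adj a b) ↔
        s ∈ ({{0}, {1}, {2}, {3}, {0, 1}, {2, 3}} : Finset (Finset (Fin 4))) := by
    decide
  have hmax : ∀ s : Finset (Fin 4),
      (s ∈ ({{0}, {1}, {2}, {3}, {0, 1}, {2, 3}} : Finset (Finset (Fin 4))) ∧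
        ∀ t ∈ ({{0}, {1}, {2}, {3}, {0, 1}, {2, 3}} : Finset (Finset (Fin 4))),
          s ⊆ t → t ⊆ s) ↔ s = {0, 1} ∨ s = {2, 3} := by
    decide
  have hmem : ∀ s, s ∈ (largestComplex fourCycleᶜ).faces ↔
      s ∈ ({{0}, {1}, {2}, {3}, {0, 1}, {2, 3}} : Finset (Finset (Fin 4))) := fun s =>
    (and_congr_right fun _ => ⟨fun h a ha b hb hab => (h ha hb hab).2,
      fun h a ha b hb hab => ⟨hab, h a ha b hb hab⟩⟩).trans (hface s)
  ext s
  refine Iff.trans ?_ (hmax s)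
  simp only [facets, Set.mem_ofPred_eq, Maximal, hmem]

theorem edgeRingPd_eq {V : Type v} {k : Type u} [Field k] {G : SimpleGraph V} {n : ℕ}
    (h : PdLT (MvPolynomial V k) (EdgeRing k G) (n + 1))
    (h' : ¬ PdLT (MvPolynomial V k) (EdgeRing k G) n) : edgeRingPd k G = n :=
  le_antisymm ((projectiveDimension_le_iff _ _).mpr h) ((projectiveDimension_ge_iff _ _).mpr h')

theorem not_pdLT_maxDegree {V : Type v} [Fintype V] {k : Type u} [Field k] (G : SimpleGraph V)
    [DecidableRel G.Adj] : ¬ PdLT (MvPolynomial V k) (EdgeRing k G) G.maxDegree := by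
  cases isEmpty_or_nonempty V
  -- Without vertices the maximal degree is 0, and the claim is only that the ring is nonzero.
  · rw [SimpleGraph.maxDegree_of_subsingleton, ← Finset.card_empty]
    exact not_pdLT_card (one_notMem_edgeIdeal G) ∅ (by simp)
  · obtain ⟨w, hw⟩ := G.exists_maximal_degree_vertex
    rw [hw, ← SimpleGraph.card_neighborFinset_eq_degree]
    exact not_pdLT_card_neighbors G w _ fun a ha => (G.mem_neighborFinset w a).mp ha

theorem edgeRingPd_eq_maxDegree {V : Type v} [Fintype V] {k : Type u} [Field k]
    {G : SimpleGraph V} [DecidableRel G.Adj] (hV : Fintype.card V ≤ 4) (h2 : TwoEdgeFree G)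
    (h4 : FourCycleFree G) : edgeRingPd k G = G.maxDegree := by
  refine edgeRingPd_eq (pdLT_edgeRing_of_degreeLE k _ G Finset.univ rfl hV
    (fun _ _ _ => Finset.mem_univ _) h2 h4 _ fun w N hN => ?_) (not_pdLT_maxDegree G)
  refine le_trans ?_ (G.degree_le_maxDegree w)
  rw [← SimpleGraph.card_neighborFinset_eq_degree]
  exact Finset.card_le_card fun y hy => (G.mem_neighborFinset w y).mpr (hN y hy)

theorem card_eq_four_and_forall_mem {V : Type v} [Fintype V] (hV : Fintype.card V ≤ 4)
    {a b c d : V} (hab : a ≠ b) (hac : a ≠ c) (had : a ≠ d) (hbc : b ≠ c) (hbd : b ≠ d)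
    (hcd : c ≠ d) : Fintype.card V = 4 ∧ ∀ x, x = a ∨ x = b ∨ x = c ∨ x = d := by
  classical
  have h : ({a, b, c, d} : Finset V).card = 4 := by
    rw [Finset.card_insert_of_notMem (by simp [hab, hac, had]),
      Finset.card_eq_three.mpr ⟨b, c, d, hbc, hbd, hcd, rfl⟩]
  have h' := Finset.card_le_univ ({a, b, c, d} : Finset V)
  have hV4 : Fintype.card V = 4 := by omega
  refine ⟨hV4, fun x => ?_⟩
  have hx := Finset.mem_univ x
  rw [← (Finset.card_eq_iff_eq_univ ({a, b, c, d} : Finset V)).mp (h.trans hV4.symm)] at hx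
  simpa using hx

/-- An induced 2K₂ uses four distinct vertices, hence all of `V`, so `G` consists of exactly two
disjoint edges. -/
theorem twoEdgeFree_of_hasTwoLinearResolution {V : Type v} [Fintype V] {k : Type u} [Field k]
    {G : SimpleGraph V} (hV : Fintype.card V ≤ 4)
    (h : HasTwoLinearResolution (edgeIdeal k G)) : TwoEdgeFree G := by
  intro a b c d hab hcd
  by_contra! hn
  obtain ⟨nac, nad, nbc, nbd⟩ := hn
  have hac : a ≠ c := by rintro rfl; exact nad hcd
  have had : a ≠ d := by rintro rfl; exact nac hcd.symm
  have hbc : b ≠ c := by rintro rfl; exact nbd hcd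
  have hbd : b ≠ d := by rintro rfl; exact nbc hcd.symm
  have hmem := (card_eq_four_and_forall_mem hV hab.ne hac had hbc hbd hcd.ne).2
  refine not_hasTwoLinearResolution_of_disjoint_edges hac had hbc hbd hcd.ne hab hcd ?_ h
  intro i j hij
  have nca : ¬ G.Adj c a := fun h => nac h.symm
  have nda : ¬ G.Adj d a := fun h => nad h.symm
  have ncb : ¬ G.Adj c b := fun h => nbc h.symm
  have ndb : ¬ G.Adj d b := fun h => nbd h.symm
  obtain rfl | rfl | rfl | rfl := hmem i <;> obtain rfl | rfl | rfl | rfl := hmem j <;>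
    first
    | exact absurd rfl hij.ne
    | contradiction
    | simp

/-- A chordless 4-cycle `a, b, c, d` exhausts `V`, and its cyclic order is the isomorphism. -/
theorem nonempty_iso_cycleGraph_four {V : Type v} [Fintype V] {G : SimpleGraph V}
    (hV : Fintype.card V ≤ 4) (h : ¬ FourCycleFree G) :
    Fintype.card V = 4 ∧ Nonempty (G ≃g SimpleGraph.cycleGraph 4) := by
  simp only [FourCycleFree] at h
  push Not at h
  obtain ⟨a, b, c, d, hab, hbc, hcd, hda, hac, hbd, nac, nbd⟩ := h
  obtain ⟨hV4, hmem⟩ :=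
    card_eq_four_and_forall_mem hV hab.ne hac hda.ne' hbc.ne hbd hcd.ne
  refine ⟨hV4, ⟨RelIso.symm ⟨Equiv.ofBijective ![a, b, c, d] ?_, ?_⟩⟩⟩
  · refine (Fintype.bijective_iff_surjective_and_card _).mpr ⟨fun x => ?_, by simp [hV4]⟩
    obtain rfl | rfl | rfl | rfl := hmem x
    exacts [⟨0, rfl⟩, ⟨1, rfl⟩, ⟨2, rfl⟩, ⟨3, rfl⟩]
  · have nca : ¬ G.Adj c a := fun h => nac h.symm
    have ndb : ¬ G.Adj d b := fun h => nbd h.symm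
    intro i j
    rw [Equiv.ofBijective_apply, Equiv.ofBijective_apply]
    fin_cases i <;> fin_cases j <;>
      first
      | exact iff_of_true (by assumption) (by decide)
      | exact iff_of_true (G.symm.symm _ _ (by assumption)) (by decide)
      | exact iff_of_false (by assumption) (by decide)
      | exact iff_of_false (G.irrefl) (by decide)

end FourVertices

theorem corollary2 (k : Type u) [Field k] :
    -- the 4-cycle is a counterexample
    Nonempty (fourCycle ≃g SimpleGraph.cycleGraph 4) ∧
    IsCounterexample k fourCycle ∧
    -- it is the smallest one: every counterexample has at least four vertices, and every one
    -- with exactly four vertices is a 4-cycle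
    (∀ (V : Type v) [Fintype V] (G : SimpleGraph V) [DecidableRel G.Adj],
      IsCounterexample k G →
        4 ≤ Fintype.card V ∧
        (Fintype.card V = 4 → Nonempty (G ≃g SimpleGraph.cycleGraph 4))) ∧
    -- its edge ring is the Stanley-Reisner ring of the complex with these two facets
    facets (largestComplex fourCycleᶜ) = {{0, 1}, {2, 3}} ∧
    edgeIdeal k fourCycle = stanleyReisnerIdeal k (largestComplex fourCycleᶜ) ∧
    -- the two invariants
    edgeRingPd k fourCycle = 3 ∧
    fourCycle.maxDegree = 2 := by
  have hpd : edgeRingPd k fourCycle = 3 :=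
    edgeRingPd_eq (n := 3) pdLT_edgeRing_fourCycle not_pdLT_edgeRing_fourCycle
  have hdeg : fourCycle.maxDegree = 2 := by decide
  refine ⟨⟨SimpleGraph.Iso.comap _ _⟩, ⟨hasTwoLinearResolution_fourCycle, ?_⟩, ?_,
    facets_largestComplex_compl_fourCycle, edgeIdeal_eq_stanleyReisnerIdeal k _, hpd, hdeg⟩
  · rw [hpd, hdeg]
    decide
  · intro V _ G _ hG
    -- One statement for at most four vertices yields both claims: its first half excludes fewer
    -- than four, its second identifies the graph.
    have key (hV : Fintype.card V ≤ 4) :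
        Fintype.card V = 4 ∧ Nonempty (G ≃g SimpleGraph.cycleGraph 4) :=
      nonempty_iso_cycleGraph_four hV fun h4 => hG.2 (edgeRingPd_eq_maxDegree hV
        (twoEdgeFree_of_hasTwoLinearResolution hV hG.1) h4)
    refine ⟨?_, fun hV => (key hV.le).2⟩
    by_contra! hlt
    have := (key hlt.le).1
    omega
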